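/- Let $\mu$ be a singular cardinal with $\kappa=\mathrm{cf}(\mu)>\aleph_0$, put $\lambda=\mu^+$, let $S\subseteq\{\delta<\lambda:\mathrm{cf}(\delta)=\kappa\}$ be stationary in $\lambda$, and let $\bar C=\langle C_\delta:\delta\in S\rangle$ be an $S$-club system, i.e. $C_\delta$ is a club of $\delta$ for every $\delta\in S$. For a set $A$ of ordinals let $\mathrm{acc}(A)$ be the set of those $\alpha\in A$ with $\alpha\neq 0$ and $\alpha=\sup(A\cap\alpha)$, and let $\mathrm{nacc}(A)=A\setminus\mathrm{acc}(A)$. For $\delta\in S$ let $$J^{b[\mu]}_{C_\delta}=\bigl\{A\subseteq C_\delta:\text{ for some }\theta<\mu,\ \delta>\sup\{\alpha\in A:\alpha\in\mathrm{nacc}(C_\delta)\text{ and }\mathrm{cf}(\alpha)>\theta\}\bigr\}.$$ Assume $\lambda\notin\mathrm{id}^p(\bar C,\bar J^{b[\mu]})$, where $\bar J^{b[\mu]}=\langle J^{b[\mu]}_{C_\delta}:\delta\in S\rangle$ and $\mathrm{id}^p(\bar C,\bar J)$ is the family of all $A\subseteq\lambda$ such that for some club $E$ of $\lambda$ there is no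 $\delta\in A\cap S\cap\mathrm{acc}(E)$ with $E\cap C_\delta\notin J_\delta$. (That is: for every club $E$ of $\lambda$ there is $\delta\in S\cap\mathrm{acc}(E)$ with $E\cap C_\delta\notin J^{b[\mu]}_{C_\delta}$.) Then there is a strict $\lambda$-club system $\bar e^*=\langle e^*_\beta:\beta<\lambda\rangle$ (each $e^*_\beta$ is a club of $\beta$ of order type $\mathrm{cf}(\beta)$) such that for every club $E$ of $\lambda$, for stationarily many $\delta\in S$: for every $\alpha<\delta$ and every $\theta<\mu$ there is $\beta\in\mathrm{nacc}(C_\delta)$ with $\beta>\alpha$ and $\mathrm{cf}(\beta)>\theta$ such that $$\{\gamma\in e^*_\beta:\gamma\in E\text{ and }\min(e^*_\beta\setminus(\gamma+1))\in E\}$$ is a stationary subset of $\beta$. -/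

import Mathlib

universe u

open Cardinal Ordinal Order Set

/-- `C` is a club of the ordinal `o`: a subset of `o`, closed in `o` and cofinal in `o`. -/
def IsClubOf (C : Set Ordinal.{u}) (o : Ordinal.{u}) : Prop :=
  C ⊆ Iio o ∧ IsClub {x : Iio o | (x : Ordinal.{u}) ∈ C}

/-- `A` is a stationary subset of the ordinal `o`: it is a subset of `o` and meets every club
of `o`. -/
def IsStationaryOf (A : Set Ordinal.{u}) (o : Ordinal.{u}) : Prop :=
  A ⊆ Iio o ∧ IsStationary {x : Iio o | (x : Ordinal.{u}) ∈ A}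

/-- The accumulation points of `A`: the `α ∈ A` with `α = sup (A ∩ α)`, `α ≠ 0`. -/
def accPoints (A : Set Ordinal.{u}) : Set Ordinal.{u} :=
  {α | α ∈ A ∧ α ≠ 0 ∧ ∀ ξ < α, ∃ η ∈ A, ξ < η ∧ η < α}

/-- The nonaccumulation points of `A`. -/
def naccPoints (A : Set Ordinal.{u}) : Set Ordinal.{u} := A \ accPoints A

/-- `C = ⟨C δ : δ ∈ S⟩` is an `S`-club system (values of `C` outside `S` are irrelevant). -/
def IsClubSystem (S : Set Ordinal.{u}) (C : Ordinal.{u} → Set Ordinal.{u}) : Prop :=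
  ∀ δ ∈ S, IsClubOf (C δ) δ

/-- A strict `S`-club system: each `C δ`, `δ ∈ S`, has order type `cf δ`. -/
def IsStrictClubSystem (S : Set Ordinal.{u}) (C : Ordinal.{u} → Set Ordinal.{u}) : Prop :=
  IsClubSystem S C ∧
    ∀ δ ∈ S, Ordinal.type (fun x y : C δ => x < y) = Ordinal.lift.{u + 1} δ.cof.ord

/-- The ideal `J^{b[μ]}` on a club `C` of `δ`: the sets `A ⊆ C` such that, for some `θ < μ`,
the nonaccumulation points of `C` which lie in `A` and have cofinality `> θ` are bounded
below `δ`. -/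
def idealJb (μ : Cardinal.{u}) (δ : Ordinal.{u}) (C : Set Ordinal.{u}) :
    Set (Set Ordinal.{u}) :=
  {A | A ⊆ C ∧ ∃ θ < μ, ∃ α < δ, ∀ β ∈ A, β ∈ naccPoints C → θ < β.cof → β ≤ α}

/-- The ideal `id^p(C, J)` on `l`: the sets `A ⊆ l` such that, for some club `E` of `l`, there is
no `δ ∈ A ∩ S ∩ acc E` with `E ∩ C δ ∉ J δ`. -/
def idP (l : Ordinal.{u}) (S : Set Ordinal.{u}) (C : Ordinal.{u} → Set Ordinal.{u})
    (J : Ordinal.{u} → Set (Set Ordinal.{u})) : Set (Set Ordinal.{u}) :=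
  {A | A ⊆ Iio l ∧ ∃ E, IsClubOf E l ∧ ∀ δ ∈ A, δ ∈ S → δ ∈ accPoints E → E ∩ C δ ∈ J δ}

/-! ### Clubs of ordinals -/

/-! The hypothesis says that the nonaccumulation points of the `C δ` guess clubs. This is upgraded
twice, each time by running a supposed failure `ω` times (`exists_guesses`): every candidate system
`e n` has a bad club, folded into a decreasing sequence `E n`, and `e (n + 1)` is built from `E n`.
At a good `β`, guessed by means of `⋂ n, E n`, a nonincreasing sequence of ordinals stabilizes,
which shows that some stage was not bad at `β`. Since `cf μ` and `cf δ` are uncountable, one stage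
serves frequently many `β`, a contradiction. The first upgrade thins the clubs until, at
stationarily many of their points in `E`, the gap that follows meets `E`
(`exists_isStationaryOf_gapPoints`). The second replaces each point of a club by the last point of
`E n` not above it, so that the ends of the gaps also fall into the guessed club
(`exists_isStationaryOf_pairPoints`). -/

theorem isClubOf_iff {C : Set Ordinal.{u}} {o : Ordinal.{u}} :
    IsClubOf C o ↔ C ⊆ Iio o ∧ (∀ x < o, ∃ y ∈ C, x ≤ y) ∧
      ∀ x < o, x ≠ 0 → (∀ ξ < x, ∃ η ∈ C, ξ < η ∧ η < x) → x ∈ C := by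
  constructor
  · rintro ⟨h1, h2⟩
    refine ⟨h1, fun x hx ↦ ?_, fun x hx h0 hlim ↦ ?_⟩
    · obtain ⟨y, hy, hxy⟩ := h2.isCofinal ⟨x, hx⟩
      exact ⟨y, hy, hxy⟩
    · refine h2.isLUB_mem (x := ⟨x, hx⟩)
        (t := {y : Iio o | (y : Ordinal) ∈ C ∧ (y : Ordinal) < x}) (fun y hy ↦ hy.1) ?_ ⟨?_, ?_⟩
      · obtain ⟨η, hη, -, h⟩ := hlim 0 (pos_iff_ne_zero.2 h0)
        exact ⟨⟨η, h1 hη⟩, hη, h⟩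
      · exact fun y hy ↦ hy.2.le
      · intro b hb
        by_contra hlt
        obtain ⟨η, hη, h, h'⟩ := hlim b (not_le.1 hlt)
        exact (hb (a := ⟨η, h1 hη⟩) ⟨hη, h'⟩).not_gt h
  · rintro ⟨h1, h2, h3⟩
    refine ⟨h1, ?_, ?_⟩
    · rw [dirSupClosed_iff_of_linearOrder]
      rintro d hd ⟨d0, hd0⟩ ⟨a, ha⟩ hlub
      by_cases had : (⟨a, ha⟩ : Iio o) ∈ d
      · exact hd had
      have hlt : ∀ y ∈ d, (y : Ordinal) < a := fun y hy ↦
        lt_of_le_of_ne (hlub.1 hy) fun h ↦ had (by convert hy; exact h.symm)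
      refine h3 a ha ((zero_le).trans_lt (hlt d0 hd0)).ne' fun ξ hξ ↦ ?_
      obtain ⟨y, hy, h, -⟩ := hlub.exists_between (b := ⟨ξ, hξ.trans ha⟩) hξ
      exact ⟨y, hd hy, h, hlt y hy⟩
    · rintro ⟨x, hx⟩
      obtain ⟨y, hy, hxy⟩ := h2 x hx
      exact ⟨⟨y, h1 hy⟩, hy, hxy⟩

theorem IsClubOf.exists_ge {C : Set Ordinal.{u}} {o x : Ordinal.{u}} (h : IsClubOf C o)
    (hx : x < o) : ∃ y ∈ C, x ≤ y :=
  (isClubOf_iff.1 h).2.1 x hx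

theorem IsClubOf.mem_of_limit {C : Set Ordinal.{u}} {o x : Ordinal.{u}} (h : IsClubOf C o)
    (hx : x < o) (h0 : x ≠ 0) (hlim : ∀ ξ < x, ∃ η ∈ C, ξ < η ∧ η < x) : x ∈ C :=
  (isClubOf_iff.1 h).2.2 x hx h0 hlim

theorem cof_Iio_ne_aleph0 {o : Ordinal.{u}} (ho : ℵ₀ < o.cof) : Order.cof (Iio o) ≠ ℵ₀ := by
  rw [cof_Iio, ← lift_cof]
  exact (aleph0_lt_lift.2 ho).ne'

theorem IsClubOf.iInter {o : Ordinal.{u}} (ho : ℵ₀ < o.cof) {C : ℕ → Set Ordinal.{u}}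
    (hC : ∀ n, IsClubOf (C n) o) : IsClubOf (⋂ n, C n) o := by
  refine ⟨(iInter_subset _ 0).trans (hC 0).1, ?_⟩
  convert IsClub.iInter_of_countable (cof_Iio_ne_aleph0 ho) fun n ↦ (hC n).2
  ext x
  simp

theorem IsClubOf.inter {o : Ordinal.{u}} (ho : ℵ₀ < o.cof) {C D : Set Ordinal.{u}}
    (hC : IsClubOf C o) (hD : IsClubOf D o) : IsClubOf (C ∩ D) o :=
  ⟨inter_subset_left.trans hC.1, hC.2.inter (cof_Iio_ne_aleph0 ho) hD.2⟩

theorem isSuccLimit_of_aleph0_lt_cof {o : Ordinal.{u}} (ho : ℵ₀ < o.cof) : IsSuccLimit o :=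
  one_lt_cof_iff.1 (one_lt_aleph0.trans ho)

theorem IsClubOf.exists_gt {C : Set Ordinal.{u}} {o x : Ordinal.{u}} (h : IsClubOf C o)
    (ho : ℵ₀ < o.cof) (hx : x < o) : ∃ y ∈ C, x < y := by
  obtain ⟨y, hy, hxy⟩ := h.exists_ge ((isSuccLimit_of_aleph0_lt_cof ho).succ_lt hx)
  exact ⟨y, hy, (lt_succ x).trans_le hxy⟩

/-- The trace of a club of `l` on an ordinal in which it is unbounded. -/
theorem IsClubOf.inter_Iio {E : Set Ordinal.{u}} {l o : Ordinal.{u}} (h : IsClubOf E l)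
    (hol : o ≤ l) (hunb : ∀ x < o, ∃ y ∈ E, x ≤ y ∧ y < o) : IsClubOf (E ∩ Iio o) o := by
  refine isClubOf_iff.2 ⟨inter_subset_right, fun x hx ↦ ?_, fun x hx h0 hlim ↦ ⟨?_, hx⟩⟩
  · obtain ⟨y, hy, h1, h2⟩ := hunb x hx
    exact ⟨y, ⟨hy, h2⟩, h1⟩
  · refine h.mem_of_limit (hx.trans_le hol) h0 fun ξ hξ ↦ ?_
    obtain ⟨η, hη, h⟩ := hlim ξ hξ
    exact ⟨η, hη.1, h⟩

theorem IsClubOf.exists_isGreatest {E : Set Ordinal.{u}} {l a x : Ordinal.{u}} (h : IsClubOf E l)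
    (hx : x ∈ E) (hxa : x ≤ a) (ha : a < l) : ∃ y, IsGreatest (E ∩ Iic a) y := by
  have hbdd : BddAbove (E ∩ Iic a) := ⟨a, fun y hy ↦ hy.2⟩
  have hle : sSup (E ∩ Iic a) ≤ a := csSup_le ⟨x, hx, hxa⟩ fun y hy ↦ hy.2
  refine ⟨sSup (E ∩ Iic a), ?_, fun y hy ↦ le_csSup hbdd hy⟩
  by_contra hmem
  have hnot : sSup (E ∩ Iic a) ∉ E := fun h' ↦ hmem ⟨h', hle⟩
  have hlt : ∀ y ∈ E ∩ Iic a, y < sSup (E ∩ Iic a) := fun y hy ↦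
    lt_of_le_of_ne (le_csSup hbdd hy) fun h' ↦ hnot (h' ▸ hy.1)
  refine hnot (h.mem_of_limit (hle.trans_lt ha)
    ((zero_le).trans_lt (hlt x ⟨hx, hxa⟩)).ne' fun ξ hξ ↦ ?_)
  obtain ⟨y, hy, hξy⟩ := exists_lt_of_lt_csSup (s := E ∩ Iic a) ⟨x, hx, hxa⟩ hξ
  exact ⟨y, hy.1, hξy, hlt y hy⟩

/-! ### Stationary subsets of ordinals -/

theorem IsStationaryOf.exists_mem {A C : Set Ordinal.{u}} {o : Ordinal.{u}}
    (hA : IsStationaryOf A o) (hC : IsClubOf C o) : ∃ x ∈ A, x ∈ C := by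
  obtain ⟨x, hx, hx'⟩ := hA.2 hC.2
  exact ⟨x, hx, hx'⟩

theorem isStationaryOf_of_forall {A : Set Ordinal.{u}} {o : Ordinal.{u}} (hA : A ⊆ Iio o)
    (h : ∀ C, IsClubOf C o → ∃ x ∈ A, x ∈ C) : IsStationaryOf A o := by
  refine ⟨hA, fun t ht ↦ ?_⟩
  obtain ⟨_, hx, y, hy, rfl⟩ := h (Subtype.val '' t) ⟨by rintro _ ⟨y, -, rfl⟩; exact y.2, by
    convert ht
    ext x
    exact ⟨fun ⟨y, hy, h⟩ ↦ Subtype.ext h ▸ hy, fun h ↦ ⟨x, h, rfl⟩⟩⟩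
  exact ⟨y, hx, hy⟩

theorem exists_isClubOf_disjoint {A : Set Ordinal.{u}} {o : Ordinal.{u}} (hA : A ⊆ Iio o)
    (h : ¬ IsStationaryOf A o) : ∃ C, IsClubOf C o ∧ ∀ x ∈ C, x ∉ A := by
  by_contra! hcon
  exact h (isStationaryOf_of_forall hA fun C hC ↦
    (hcon C hC).imp fun x hx ↦ ⟨hx.2, hx.1⟩)

theorem IsStationaryOf.mono {A B : Set Ordinal.{u}} {o : Ordinal.{u}} (hA : IsStationaryOf A o)
    (h : A ⊆ B) (hB : B ⊆ Iio o) : IsStationaryOf B o :=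
  ⟨hB, hA.2.mono fun _ hx ↦ h hx⟩

theorem IsStationaryOf.exists_nat {A : Set Ordinal.{u}} {o : Ordinal.{u}} (ho : ℵ₀ < o.cof)
    (hA : IsStationaryOf A o) (P : ℕ → Ordinal.{u} → Prop) (hP : ∀ x ∈ A, ∃ n, P n x) :
    ∃ n, IsStationaryOf {x | x ∈ A ∧ P n x} o := by
  have := (isStationary_iUnion_iff_of_countable (cof_Iio_ne_aleph0 ho)
    (f := fun n ↦ {x : Iio o | (x : Ordinal) ∈ A ∧ P n x})).1 <| hA.2.mono fun x hx ↦ by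
      obtain ⟨n, hn⟩ := hP x hx
      exact mem_iUnion.2 ⟨n, hx, hn⟩
  obtain ⟨n, hn⟩ := this
  exact ⟨n, fun x hx ↦ hA.1 hx.1, hn⟩

/-! ### Strict clubs -/

/-- `c` is a club of `b` all of whose proper initial segments have cardinality less than `cof b`;
equivalently, a club of `b` of order type `cof b`. -/
def IsStrictClubOf (c : Set Ordinal.{u}) (b : Ordinal.{u}) : Prop :=
  IsClubOf c b ∧ ∀ x < b, #(c ∩ Iio x : Set Ordinal.{u}) < Cardinal.lift.{u + 1} b.cof

theorem IsStrictClubOf.mono {c d : Set Ordinal.{u}} {b : Ordinal.{u}} (hc : IsStrictClubOf c b)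
    (hdc : d ⊆ c) (hd : IsClubOf d b) : IsStrictClubOf d b :=
  ⟨hd, fun x hx ↦ (mk_le_mk_of_subset (inter_subset_inter_left _ hdc)).trans_lt (hc.2 x hx)⟩

theorem IsClubOf.lift_cof_le {c : Set Ordinal.{u}} {b : Ordinal.{u}} (hc : IsClubOf c b) :
    Cardinal.lift.{u + 1} b.cof ≤ #c := by
  have h := Order.cof_le hc.2.isCofinal
  rw [cof_Iio, ← lift_cof] at h
  refine h.trans (mk_le_of_injective (f := fun x ↦ (⟨x.1.1, x.2⟩ : c)) fun x y hxy ↦ ?_)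
  exact Subtype.ext (Subtype.ext (Subtype.mk.inj hxy))

/-- A larger order type would give a point of `c` with `cof b` predecessors; a smaller one would
contradict cofinality of `c`. -/
theorem IsStrictClubOf.type_eq {c : Set Ordinal.{u}} {b : Ordinal.{u}} (hc : IsStrictClubOf c b) :
    Ordinal.type (fun x y : c => x < y) = Ordinal.lift.{u + 1} b.cof.ord := by
  rw [lift_ord]
  apply le_antisymm
  · by_contra! hlt
    obtain ⟨a, ha⟩ := typein_surj (fun x y : c => x < y) hlt
    have h1 := card_typein (r := fun x y : c => x < y) a
    rw [ha, card_ord] at h1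
    refine (hc.2 a (hc.1.1 a.2)).not_ge (h1.le.trans ?_)
    refine mk_le_of_injective (f := fun y ↦ (⟨y.1.1, y.1.2, y.2⟩ : (c ∩ Iio a.1 : Set _)))
      fun x y hxy ↦ ?_
    exact Subtype.ext (Subtype.ext (Subtype.mk.inj hxy))
  · rw [ord_le, card_type]
    exact hc.1.lift_cof_le

theorem IsStrictClubOf.mk_eq {c : Set Ordinal.{u}} {b : Ordinal.{u}} (hc : IsStrictClubOf c b) :
    #c = Cardinal.lift.{u + 1} b.cof := by
  have := congrArg Ordinal.card hc.type_eq
  rwa [card_type, lift_ord, card_ord] at this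

theorem exists_isStrictClubOf (b : Ordinal.{u}) : ∃ c, IsStrictClubOf c b := by
  rcases zero_or_succ_or_isSuccLimit b with rfl | ⟨a, rfl⟩ | hb
  · exact ⟨∅, isClubOf_iff.2 ⟨empty_subset _, by simp, by simp⟩, by simp⟩
  · refine ⟨{a}, isClubOf_iff.2 ⟨by simp, fun x hx ↦ ⟨a, rfl, lt_succ_iff.1 hx⟩, ?_⟩, ?_⟩
    · intro x hx h0 h
      obtain ⟨η, rfl, -, h'⟩ := h 0 (pos_iff_ne_zero.2 h0)
      exact absurd (lt_succ_iff.1 hx) h'.not_ge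
    · intro x hx
      have : ({a} ∩ Iio x : Set Ordinal.{u}) = ∅ := by
        ext y
        simp only [mem_inter_iff, mem_singleton_iff, mem_Iio, mem_empty_iff_false, iff_false]
        rintro ⟨rfl, h⟩
        exact (lt_succ_iff.1 hx).not_gt h
      simp [this]
  obtain ⟨f, hf⟩ := exists_isFundamentalSeq (o := b) rfl
  have hcof : ∀ x < b, ∃ i, x < (f i : Ordinal) := fun x hx ↦ by
    obtain ⟨_, ⟨i, rfl⟩, hi⟩ := hf.isCofinal_range ⟨succ x, hb.succ_lt hx⟩
    exact ⟨i, (lt_succ x).trans_le hi⟩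
  have hcofb : ℵ₀ ≤ b.cof := aleph0_le_cof_iff.2 (one_lt_cof_iff.2 hb)
  -- The closure in `b` of the range of a fundamental sequence.
  set c : Set Ordinal.{u} := {x | x < b ∧ ((∃ i, x = f i) ∨
    ∀ ξ < x, ∃ i, ξ < (f i : Ordinal) ∧ (f i : Ordinal) < x)} with hc
  refine ⟨c, isClubOf_iff.2 ⟨fun x hx ↦ hx.1, fun x hx ↦ ?_, fun x hx h0 hlim ↦ ⟨hx, .inr ?_⟩⟩, ?_⟩
  · obtain ⟨i, hi⟩ := hcof x hx
    exact ⟨f i, ⟨(f i).2, .inl ⟨i, rfl⟩⟩, hi.le⟩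
  · intro ξ hξ
    obtain ⟨η, ⟨-, ⟨i, rfl⟩ | h⟩, h1, h2⟩ := hlim ξ hξ
    · exact ⟨i, h1, h2⟩
    · obtain ⟨i, h3, h4⟩ := h ξ h1
      exact ⟨i, h3, h4.trans h2⟩
  · intro x hx
    obtain ⟨i₀, hi₀⟩ := hcof x hx
    have key : ∀ y : (c ∩ Iio x : Set Ordinal.{u}), ∃ j, IsLeast {i | (y : Ordinal) < f i} j :=
      fun y ↦ ⟨_, WellFounded.min_mem wellFounded_lt _ (hcof y y.2.1.1),
        fun i hi ↦ WellFounded.min_le wellFounded_lt hi⟩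
    choose g hg using key
    -- For `y < z` in `c` some `f i` lies in `(y, z]`, so the first index past `y` is not past `z`.
    have hinj : Function.Injective g := by
      have : ∀ y z, g y = g z → ¬ (y : Ordinal) < z := by
        intro y z hyz hlt
        obtain ⟨i, hi, hi'⟩ : ∃ i, (y : Ordinal) < f i ∧ (f i : Ordinal) ≤ z := by
          obtain ⟨i, hi⟩ | h := z.2.1.2
          · exact ⟨i, hi ▸ hlt, hi.ge⟩
          · obtain ⟨i, hi⟩ := h y hlt
            exact ⟨i, hi.1, hi.2.le⟩
        have h1 : g z ≤ i := hyz ▸ (hg y).2 hi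
        exact ((hg z).1.trans_le (Subtype.coe_le_coe.2 (hf.strictMono.monotone h1))).not_ge hi'
      intro y z hyz
      exact Subtype.ext (le_antisymm (not_lt.1 (this z y hyz.symm)) (not_lt.1 (this y z hyz)))
    have hle : ∀ y, (g y : Ordinal) < succ (i₀ : Ordinal) := fun y ↦
      lt_succ_iff.2 ((hg y).2 ((show (y : Ordinal) < x from y.2.2).trans hi₀))
    refine (mk_le_of_injective (f := fun y ↦ (⟨g y, hle y⟩ : Iio (succ (i₀ : Ordinal))))
      fun y z h ↦ hinj (Subtype.ext (Subtype.mk.inj h))).trans_lt ?_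
    rw [Cardinal.mk_Iio_ordinal, Cardinal.lift_lt, ← lt_ord]
    exact (isSuccLimit_ord hcofb).succ_lt i₀.2

/-! ### Gluing a club to a larger club -/

/-- The set of the points `max (E ∩ [0, a])`, for `a ∈ c`. -/
def glue (E c : Set Ordinal.{u}) : Set Ordinal.{u} :=
  {y | ∃ a ∈ c, IsGreatest (E ∩ Iic a) y}

/-- A limit of glued points lies in `E`, and also in `c`, because the points of `c` producing them
interleave with them; such a point is glued to itself. Initial segments stay small because glued
points below some `y ∈ E` come from points of `c` below `y`. -/
theorem IsStrictClubOf.glue {E c : Set Ordinal.{u}} {l b : Ordinal.{u}} (hE : IsClubOf E l)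
    (hbl : b ≤ l) (hunb : ∀ x < b, ∃ y ∈ E, x ≤ y ∧ y < b) (hc : IsStrictClubOf c b) :
    IsStrictClubOf (glue E c) b := by
  refine ⟨isClubOf_iff.2 ⟨?_, ?_, ?_⟩, ?_⟩
  · rintro y ⟨a, ha, hy⟩
    exact (show y ≤ a from hy.1.2).trans_lt (hc.1.1 ha)
  · intro x hx
    obtain ⟨y, hyE, hxy, hyb⟩ := hunb x hx
    obtain ⟨a, ha, hya⟩ := hc.1.exists_ge hyb
    obtain ⟨z, hz⟩ := hE.exists_isGreatest hyE hya ((hc.1.1 ha).trans_le hbl)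
    exact ⟨z, ⟨a, ha, hz⟩, hxy.trans (hz.2 ⟨hyE, hya⟩)⟩
  · intro x hx h0 hlim
    have hxE : x ∈ E := hE.mem_of_limit (hx.trans_le hbl) h0 fun ξ hξ ↦ by
      obtain ⟨η, ⟨a, -, hη⟩, h⟩ := hlim ξ hξ
      exact ⟨η, hη.1.1, h⟩
    have hxc : x ∈ c := hc.1.mem_of_limit hx h0 fun ξ hξ ↦ by
      obtain ⟨η, ⟨a, ha, hη⟩, h1, h2⟩ := hlim ξ hξ
      refine ⟨a, ha, h1.trans_le hη.1.2, not_le.1 fun hxa ↦ ?_⟩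
      exact (hη.2 ⟨hxE, hxa⟩).not_gt h2
    exact ⟨x, hxc, ⟨hxE, mem_Iic.2 le_rfl⟩, fun y hy ↦ hy.2⟩
  · intro x hx
    obtain ⟨y, hyE, hxy, hyb⟩ := hunb x hx
    have key : ∀ z : (_root_.glue E c ∩ Iio x : Set Ordinal.{u}),
        ∃ a : (c ∩ Iio y : Set Ordinal.{u}), IsGreatest (E ∩ Iic a.1) z.1 := by
      rintro ⟨z, ⟨a, ha, hz⟩, hzx⟩
      refine ⟨⟨a, ha, mem_Iio.2 (not_le.1 fun hya ↦ ?_)⟩, hz⟩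
      exact (hxy.trans (hz.2 ⟨hyE, hya⟩)).not_gt hzx
    choose g hg using key
    refine (mk_le_of_injective (f := g) fun z w h ↦ Subtype.ext ?_).trans_lt (hc.2 y hyb)
    have := hg w
    rw [← h] at this
    exact (hg z).unique this

theorem IsStationaryOf.exists_between {A E : Set Ordinal.{u}} {b : Ordinal.{u}} (hb : ℵ₀ < b.cof)
    (hA : IsStationaryOf A b) (hAE : A ⊆ E) : ∀ x < b, ∃ y ∈ E, x ≤ y ∧ y < b := by
  intro x hx
  have hlim := isSuccLimit_of_aleph0_lt_cof hb
  have hC : IsClubOf (Ici x ∩ Iio b) b := isClubOf_iff.2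
    ⟨inter_subset_right, fun y hy ↦ ⟨max x y, ⟨mem_Ici.2 (le_max_left _ _), mem_Iio.2 (max_lt hx hy)⟩, le_max_right _ _⟩,
      fun y hy h0 h ↦ ⟨by
        obtain ⟨η, hη, -, h⟩ := h 0 (pos_iff_ne_zero.2 h0)
        exact hη.1.trans h.le, hy⟩⟩
  obtain ⟨y, hyA, hy⟩ := hA.exists_mem hC
  exact ⟨y, hAE hyA, hy⟩

/-! ### Limits of large segments of a club -/

theorem IsClubOf.exists_lt_mk_inter_Ioo {μ : Cardinal.{u}} (hμ : ℵ₀ ≤ μ) {E : Set Ordinal.{u}}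
    (hE : IsClubOf E (succ μ).ord) {x : Ordinal.{u}} (hx : x < (succ μ).ord) :
    ∃ y ∈ E, x < y ∧ Cardinal.lift.{u + 1} μ ≤ #(E ∩ Ioo x y : Set Ordinal.{u}) := by
  have hcof : (succ μ).ord.cof = succ μ := (isRegular_succ hμ).cof_ord
  have hcof0 : ℵ₀ < (succ μ).ord.cof := by rw [hcof]; exact hμ.trans_lt (lt_succ μ)
  have hlim := isSuccLimit_of_aleph0_lt_cof hcof0
  have hclub : IsClubOf (E ∩ Ioi x) (succ μ).ord := by
    refine isClubOf_iff.2 ⟨inter_subset_left.trans hE.1, fun y hy ↦ ?_, fun y hy h0 h ↦ ⟨?_, ?_⟩⟩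
    · obtain ⟨z, hz, h⟩ := hE.exists_gt hcof0 (max_lt hx hy)
      exact ⟨z, ⟨hz, (le_max_left _ _).trans_lt h⟩, ((le_max_right _ _).trans_lt h).le⟩
    · refine hE.mem_of_limit hy h0 fun ξ hξ ↦ ?_
      obtain ⟨η, hη, h⟩ := h ξ hξ
      exact ⟨η, hη.1, h⟩
    · obtain ⟨η, hη, -, h⟩ := h 0 (pos_iff_ne_zero.2 h0)
      exact lt_trans hη.2 h
  have hle : Cardinal.lift.{u + 1} μ ≤ #(E ∩ Ioi x : Set Ordinal.{u}) := by
    refine le_trans ?_ hclub.lift_cof_le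
    rw [hcof, Cardinal.lift_le]
    exact (lt_succ μ).le
  -- Cutting down to exactly `μ` points makes the set bounded, by regularity of `succ μ`.
  obtain ⟨T, hT, hTμ⟩ := le_mk_iff_exists_subset.1 hle
  have hsup : sSup T < (succ μ).ord := by
    refine sSup_lt_of_lt_cof ?_ fun i hi ↦ hE.1 (hT hi).1
    rw [hTμ, ← lift_cof, hcof, Cardinal.lift_lt]
    exact lt_succ μ
  have hbdd : BddAbove T := ⟨(succ μ).ord, fun i hi ↦ (hE.1 (hT hi).1).le⟩
  obtain ⟨y, hy, hlt⟩ := hE.exists_gt hcof0 (max_lt hx hsup)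
  refine ⟨y, hy, (le_max_left _ _).trans_lt hlt, hTμ.ge.trans (mk_le_mk_of_subset fun i hi ↦ ?_)⟩
  exact ⟨(hT hi).1, (hT hi).2, (le_csSup hbdd hi).trans_lt ((le_max_right _ _).trans_lt hlt)⟩

theorem IsClubOf.exists_subset_mk_inter_Ioo {μ : Cardinal.{u}} (hμ : ℵ₀ ≤ μ) {E : Set Ordinal.{u}}
    (hE : IsClubOf E (succ μ).ord) :
    IsClubOf {b | b ∈ E ∧ ∀ x < b, Cardinal.lift.{u + 1} μ ≤ #(E ∩ Ioo x b : Set Ordinal.{u})}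
      (succ μ).ord := by
  have hcof0 : ℵ₀ < (succ μ).ord.cof := by
    rw [(isRegular_succ hμ).cof_ord]; exact hμ.trans_lt (lt_succ μ)
  refine isClubOf_iff.2 ⟨fun b hb ↦ hE.1 hb.1, fun x hx ↦ ?_, fun x hx h0 hlim ↦ ⟨?_, ?_⟩⟩
  · choose! f hfE hlt hcard using fun x (hx : x < (succ μ).ord) ↦ hE.exists_lt_mk_inter_Ioo hμ hx
    let g : ℕ → Ordinal.{u} := fun n ↦ f^[n] x
    have hsucc : ∀ n, g (n + 1) = f (g n) := fun n ↦ Function.iterate_succ_apply' f n x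
    have hg : ∀ n, g n < (succ μ).ord := by
      intro n
      induction n with
      | zero => exact hx
      | succ n ih => exact hsucc n ▸ hE.1 (hfE _ ih)
    have hsup : ⨆ n, g n < (succ μ).ord := by
      refine lift_iSup_lt_of_lt_cof ?_ hg
      simpa using hcof0
    have hbdd : BddAbove (range g) := ⟨(succ μ).ord, by rintro _ ⟨n, rfl⟩; exact (hg n).le⟩
    have hlt' : ∀ n, g n < ⨆ n, g n := fun n ↦
      (hsucc n ▸ hlt _ (hg n)).trans_le (le_ciSup hbdd (n + 1))
    refine ⟨⨆ n, g n, ⟨hE.mem_of_limit hsup ((zero_le).trans_lt (hlt' 0)).ne' fun ξ hξ ↦ ?_,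
      fun y hy ↦ ?_⟩, (hlt' 0).le⟩
    · obtain ⟨n, hn⟩ := exists_lt_of_lt_ciSup hξ
      exact ⟨g (n + 1), hsucc n ▸ hfE _ (hg n), hn.trans (hsucc n ▸ hlt _ (hg n)), hlt' _⟩
    · obtain ⟨n, hn⟩ := exists_lt_of_lt_ciSup hy
      refine (hcard _ (hg n)).trans (mk_le_mk_of_subset fun z hz ↦ ⟨hz.1, hn.trans hz.2.1, ?_⟩)
      exact hz.2.2.trans (hsucc n ▸ hlt' (n + 1))
  · refine hE.mem_of_limit hx h0 fun ξ hξ ↦ ?_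
    obtain ⟨η, hη, h⟩ := hlim ξ hξ
    exact ⟨η, hη.1, h⟩
  · intro y hy
    obtain ⟨η, hη, h1, h2⟩ := hlim y hy
    exact (hη.2 y h1).trans (mk_le_mk_of_subset fun z hz ↦ ⟨hz.1, hz.2.1, hz.2.2.trans h2⟩)

/-! ### Guessing principles and iterations of length `ω` -/

/-- Unboundedly many nonaccumulation points of `c`, of cofinalities unbounded in `μ`,
satisfy `P`. -/
def FrequentlyNacc (μ : Cardinal.{u}) (c : Set Ordinal.{u}) (δ : Ordinal.{u})
    (P : Ordinal.{u} → Prop) : Prop :=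
  ∀ α < δ, ∀ θ < μ, ∃ β ∈ naccPoints c, α < β ∧ θ < β.cof ∧ P β

theorem FrequentlyNacc.mono {μ : Cardinal.{u}} {c : Set Ordinal.{u}} {δ : Ordinal.{u}}
    {P Q : Ordinal.{u} → Prop} (hμ : ℵ₀ < μ) (hP : FrequentlyNacc μ c δ P)
    (h : ∀ β, ℵ₀ < β.cof → P β → Q β) : FrequentlyNacc μ c δ Q := by
  intro α hα θ hθ
  obtain ⟨β, hβ, h1, h2, h3⟩ := hP α hα (max θ ℵ₀) (max_lt hθ hμ)
  exact ⟨β, hβ, h1, (le_max_left _ _).trans_lt h2, h β ((le_max_right _ _).trans_lt h2) h3⟩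

/-- If each `n` failed beyond bounds `α n`, `θ n`, the suprema of these would still be below `δ` and
`μ`. -/
theorem FrequentlyNacc.exists_nat {μ : Cardinal.{u}} {c : Set Ordinal.{u}} {δ : Ordinal.{u}}
    {P : ℕ → Ordinal.{u} → Prop} (hμ : ℵ₀ < μ.ord.cof) (hδ : ℵ₀ < δ.cof)
    (h : FrequentlyNacc μ c δ fun β ↦ ∃ n, P n β) : ∃ n, FrequentlyNacc μ c δ (P n) := by
  by_contra! hcon
  unfold FrequentlyNacc at hcon
  push Not at hcon
  choose α hα θ hθ hcon using hcon
  have hαsup : ⨆ n, α n < δ := lift_iSup_lt_of_lt_cof (by simpa using hδ) hα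
  have hθsup : ⨆ n, θ n < μ := lift_iSup_lt_of_lt_cof_ord (by simpa using hμ) hθ
  obtain ⟨β, hβ, h1, h2, n, hn⟩ := h _ hαsup _ hθsup
  have hαb : BddAbove (range α) := ⟨δ, by rintro _ ⟨n, rfl⟩; exact (hα n).le⟩
  have hθb : BddAbove (range θ) := ⟨μ, by rintro _ ⟨n, rfl⟩; exact (hθ n).le⟩
  exact hcon n β hβ ((le_ciSup hαb n).trans_lt h1) ((le_ciSup hθb n).trans_lt h2) hn

/-- For every club `E` of `l` there is `δ ∈ S ∩ E` such that `R E` holds at frequently many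
nonaccumulation points of `C δ`. -/
def Guesses (μ : Cardinal.{u}) (l : Ordinal.{u}) (S : Set Ordinal.{u})
    (C : Ordinal.{u} → Set Ordinal.{u}) (R : Set Ordinal.{u} → Ordinal.{u} → Prop) : Prop :=
  ∀ E, IsClubOf E l → ∃ δ ∈ S, δ ∈ E ∧ FrequentlyNacc μ (C δ) δ (R E)

theorem exists_guesses {μ : Cardinal.{u}} {l : Ordinal.{u}} {S : Set Ordinal.{u}}
    {C : Ordinal.{u} → Set Ordinal.{u}} (hμ : ℵ₀ < μ.ord.cof) (hl : ℵ₀ < l.cof)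
    (hS : ∀ δ ∈ S, ℵ₀ < δ.cof) {X : Type*} (e₀ : X) (U : X → Set Ordinal.{u} → X)
    (R : X → Set Ordinal.{u} → Ordinal.{u} → Prop)
    (hR : ∀ e E F β, E ⊆ F → R e E β → R e F β)
    (h : ∀ (e : ℕ → X) (E : ℕ → Set Ordinal.{u}), (∀ n, IsClubOf (E n) l) → Antitone E →
      (∀ n, e (n + 1) = U (e n) (E n)) → ∃ δ ∈ S, (∀ n, δ ∈ E n) ∧
        FrequentlyNacc μ (C δ) δ fun β ↦ ∃ n, R (e n) (E n) β) :
    ∃ e, Guesses μ l S C (R e) := by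
  by_contra! hcon
  unfold Guesses at hcon
  push Not at hcon
  choose F hF hFR using hcon
  let s : ℕ → X × Set Ordinal.{u} := fun n ↦ Nat.rec (e₀, F e₀)
    (fun _ p ↦ (U p.1 p.2, p.2 ∩ F (U p.1 p.2))) n
  have hclub : ∀ n, IsClubOf (s n).2 l := by
    intro n
    induction n with
    | zero => exact hF e₀
    | succ n ih => exact ih.inter hl (hF _)
  have hsub : ∀ n, (s n).2 ⊆ F (s n).1 := by
    intro n
    cases n with
    | zero => exact subset_rfl
    | succ n => exact inter_subset_right
  obtain ⟨δ, hδS, hδ, hfreq⟩ := h (fun n ↦ (s n).1) (fun n ↦ (s n).2) hclub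
    (antitone_nat_of_succ_le fun n ↦ inter_subset_left) fun n ↦ rfl
  obtain ⟨n, hn⟩ := hfreq.exists_nat hμ (hS δ hδS)
  refine hFR (s n).1 δ hδS (hsub n (hδ n)) fun α hα θ hθ ↦ ?_
  obtain ⟨β, h1, h2, h3, h4⟩ := hn α hα θ hθ
  exact ⟨β, h1, h2, h3, hR _ _ _ _ (hsub n) h4⟩

/-- Systems of clubs of order type `cof b` in all ordinals `b`. -/
abbrev StrictSystem : Type (u + 1) :=
  {e : Ordinal.{u} → Set Ordinal.{u} // ∀ b, IsStrictClubOf (e b) b}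

theorem exists_nat_forall_ge_eq {i : ℕ → Ordinal.{u}} (hi : Antitone i) :
    ∃ n, ∀ m, n ≤ m → i m = i n := by
  obtain ⟨n, hn⟩ := WellFoundedLT.antitone_chain_condition hi
  exact ⟨n, fun m hm ↦ (hn m hm).symm⟩

/-! ### Guessing the gaps of a strict club system -/

/-- The points of `c ∩ E` such that `E` has an element above `γ` and not above the
successor of `γ` in `c`. -/
def gapPoints (c E : Set Ordinal.{u}) : Set Ordinal.{u} :=
  {γ | γ ∈ c ∧ γ ∈ E ∧ ∃ x ∈ E, γ < x ∧ ∀ η ∈ c, γ < η → x ≤ η}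

open Classical in
/-- Pass from `c` to a subclub of `b` none of whose points has in `c` a gap meeting `E`, if there
is one. -/
noncomputable def thinOut (c E : Set Ordinal.{u}) (b : Ordinal.{u}) : Set Ordinal.{u} :=
  if h : ∃ D ⊆ c, IsClubOf D b ∧ ∀ γ ∈ D, ¬ ∃ x ∈ E, γ < x ∧ ∀ η ∈ c, γ < η → x ≤ η
  then h.choose else c

theorem IsStrictClubOf.thinOut {c : Set Ordinal.{u}} {b : Ordinal.{u}} (hc : IsStrictClubOf c b)
    (E : Set Ordinal.{u}) : IsStrictClubOf (thinOut c E b) b := by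
  unfold _root_.thinOut
  split_ifs with h
  · exact hc.mono h.choose_spec.1 h.choose_spec.2.1
  · exact hc

theorem thinOut_subset (c E : Set Ordinal.{u}) (b : Ordinal.{u}) : thinOut c E b ⊆ c := by
  unfold thinOut
  split_ifs with h
  · exact h.choose_spec.1
  · exact subset_rfl

theorem not_exists_of_mem_thinOut {c E : Set Ordinal.{u}} {b γ l : Ordinal.{u}}
    (hb : ℵ₀ < b.cof) (hc : IsClubOf c b) (hE : IsClubOf E l) (hbl : b ≤ l)
    (hunb : ∀ x < b, ∃ y ∈ E, x ≤ y ∧ y < b) (hgap : ¬ IsStationaryOf (gapPoints c E) b)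
    (hγ : γ ∈ thinOut c E b) : ¬ ∃ x ∈ E, γ < x ∧ ∀ η ∈ c, γ < η → x ≤ η := by
  have h : ∃ D ⊆ c, IsClubOf D b ∧ ∀ γ ∈ D, ¬ ∃ x ∈ E, γ < x ∧ ∀ η ∈ c, γ < η → x ≤ η := by
    obtain ⟨D, hD, hDg⟩ := exists_isClubOf_disjoint (fun x hx ↦ hc.1 hx.1) hgap
    refine ⟨D ∩ (c ∩ (E ∩ Iio b)), fun x hx ↦ hx.2.1,
      hD.inter hb (hc.inter hb (hE.inter_Iio hbl hunb)), fun γ hγ hex ↦ ?_⟩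
    exact hDg γ hγ.1 ⟨hγ.2.1, hγ.2.2.1, hex⟩
  rw [thinOut, dif_pos h] at hγ
  exact h.choose_spec.2.2 γ hγ

theorem exists_isStationaryOf_gapPoints {μ : Cardinal.{u}} {l b : Ordinal.{u}}
    {c E : ℕ → Set Ordinal.{u}} (hb : ℵ₀ < b.cof) (hbμ : b.cof < μ) (hbl : b ≤ l)
    (hc : ∀ n, IsStrictClubOf (c n) b)
    (hcE : ∀ n, c (n + 1) = thinOut (c n) (E n) b) (hE : ∀ n, IsClubOf (E n) l)
    (hlarge : ∀ x < b, Cardinal.lift.{u + 1} μ ≤ #((⋂ n, E n) ∩ Ioo x b : Set Ordinal.{u})) :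
    ∃ n, IsStationaryOf (gapPoints (c n) (E n)) b := by
  by_contra! hcon
  have hunb : ∀ n, ∀ x < b, ∃ y ∈ E n, x ≤ y ∧ y < b := by
    intro n x hx
    have : #((⋂ n, E n) ∩ Ioo x b : Set Ordinal.{u}) ≠ 0 := fun h0 ↦ by
      have := hlarge x hx
      rw [h0, nonpos_iff_eq_zero, Cardinal.lift_eq_zero] at this
      exact not_lt_zero (this ▸ hbμ)
    obtain ⟨⟨y, hy, hxy⟩⟩ := mk_ne_zero_iff.1 this
    exact ⟨y, mem_iInter.1 hy n, hxy.1.le, hxy.2⟩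
  have hgap : ∀ n, ∀ γ ∈ c (n + 1), ¬ ∃ x ∈ E n, γ < x ∧ ∀ η ∈ c n, γ < η → x ≤ η := fun n γ hγ ↦
    not_exists_of_mem_thinOut hb (hc n).1 (hE n) hbl (hunb n) (hcon n) (hcE n ▸ hγ)
  have hanti : Antitone c := antitone_nat_of_succ_le fun n ↦ hcE n ▸ thinOut_subset _ _ _
  have hb0 : 0 < b := (isSuccLimit_of_aleph0_lt_cof hb).bot_lt
  -- A point common to all `c n`, so that each `c n` has a last point not above the `x` chosen next.
  obtain ⟨γ₀, hγ₀, -⟩ := (IsClubOf.iInter hb fun n ↦ (hc n).1).exists_ge hb0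
  have hγ₀b : γ₀ < b := (hc 0).1.1 (mem_iInter.1 hγ₀ 0)
  -- There are at least `μ` candidates, but `c 0` has only `cof b < μ` points.
  obtain ⟨x, ⟨hxE, hx⟩, hxc⟩ : ∃ x ∈ (⋂ n, E n) ∩ Ioo γ₀ b, x ∉ c 0 := by
    by_contra! hsub
    have := (hlarge γ₀ hγ₀b).trans (mk_le_mk_of_subset hsub)
    rw [(hc 0).mk_eq, Cardinal.lift_le] at this
    exact this.not_gt hbμ
  choose i hi using fun n ↦ (hc n).1.exists_isGreatest (mem_iInter.1 hγ₀ n) hx.1.le hx.2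
  obtain ⟨n, hn⟩ := exists_nat_forall_ge_eq (i := i)
    (antitone_nat_of_succ_le fun n ↦ (hi n).2 ⟨hanti n.le_succ (hi (n + 1)).1.1, (hi (n + 1)).1.2⟩)
  have hmem : i n ∈ c (n + 1) := hn (n + 1) n.le_succ ▸ (hi (n + 1)).1.1
  have hlt : i n < x := lt_of_le_of_ne (hi n).1.2 fun h ↦
    hxc (h ▸ hanti n.zero_le (hi n).1.1)
  -- The stable point `i n` survived the thinning although `x ∈ E n` lies in the gap of `c n` after
  -- it.
  refine hgap n _ hmem ⟨x, mem_iInter.1 hxE n, hlt, fun η hη hlt' ↦ ?_⟩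
  by_contra! hηx
  exact ((hi n).2 ⟨hη, hηx.le⟩).not_gt hlt'

theorem exists_guesses_gapPoints {μ : Cardinal.{u}} {S : Set Ordinal.{u}}
    {C : Ordinal.{u} → Set Ordinal.{u}} (hμ : μ.IsSingular) (hμ0 : ℵ₀ < μ.ord.cof)
    (hS : ∀ δ ∈ S, ℵ₀ < δ.cof)
    (hC : Guesses μ (succ μ).ord S C fun E β ↦ β ∈ E) :
    ∃ e : StrictSystem.{u}, Guesses μ (succ μ).ord S C
      fun E β ↦ IsStationaryOf (gapPoints (e.1 β) E) β := by
  have hμ1 : ℵ₀ < μ := hμ0.trans_le (cof_ord_le μ)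
  have hl : ℵ₀ < (succ μ).ord.cof := by
    rw [(isRegular_succ hμ1.le).cof_ord]; exact hμ1.trans (lt_succ μ)
  choose e₀ he₀ using exists_isStrictClubOf.{u}
  refine exists_guesses hμ0 hl hS (⟨e₀, he₀⟩ : StrictSystem.{u})
    (fun e E ↦ ⟨fun b ↦ thinOut (e.1 b) E b, fun b ↦ (e.2 b).thinOut E⟩) _ ?_ ?_
  · intro e E F β hEF h
    refine h.mono ?_ fun x hx ↦ (e.2 β).1.1 hx.1
    rintro γ ⟨h1, h2, x, hx, h3⟩
    exact ⟨h1, hEF h2, x, hEF hx, h3⟩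
  · intro e E hE _ he
    obtain ⟨δ, hδS, hδ, hfreq⟩ :=
      hC _ ((IsClubOf.iInter hl hE).exists_subset_mk_inter_Ioo hμ1.le)
    refine ⟨δ, hδS, mem_iInter.1 hδ.1, hfreq.mono hμ1 fun β hβ hβE ↦ ?_⟩
    have hβl : β < (succ μ).ord := hE 0 |>.1 (mem_iInter.1 hβE.1 0)
    -- Cofinalities are regular or finite, so they cannot equal the singular `μ`.
    have hβμ : β.cof < μ := by
      refine lt_of_le_of_ne ((cof_le_card β).trans (lt_succ_iff.1 (lt_ord.1 hβl))) fun h ↦ ?_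
      exact hμ.cof_ord_lt.ne (h ▸ cof_ord_cof β)
    exact exists_isStationaryOf_gapPoints hβ hβμ hβl.le (fun n ↦ (e n).2 β)
      (fun n ↦ by rw [he n]) hE hβE.2

/-! ### Guessing successive pairs of points -/

/-- The points of `c ∩ E` whose successor in `c` lies in `E`. -/
def pairPoints (c E : Set Ordinal.{u}) : Set Ordinal.{u} :=
  {γ | γ ∈ c ∧ γ ∈ E ∧ ∃ η ∈ E, IsLeast {x | x ∈ c ∧ γ < x} η}

open Classical in
/-- Glue every club `e b` to `E` where this gives a strict club of `b`. -/
noncomputable def StrictSystem.glue (e : StrictSystem.{u}) (E : Set Ordinal.{u}) :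
    StrictSystem.{u} :=
  ⟨fun b ↦ if IsStrictClubOf (_root_.glue E (e.1 b)) b then _root_.glue E (e.1 b) else e.1 b,
    fun b ↦ by
      beta_reduce
      split_ifs with h
      · exact h
      · exact e.2 b⟩

theorem StrictSystem.glue_apply {e : StrictSystem.{u}} {E : Set Ordinal.{u}} {l b : Ordinal.{u}}
    (hE : IsClubOf E l) (hbl : b ≤ l) (hunb : ∀ x < b, ∃ y ∈ E, x ≤ y ∧ y < b) :
    (e.glue E).1 b = _root_.glue E (e.1 b) :=
  if_pos ((e.2 b).glue hE hbl hunb)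

theorem exists_isStationaryOf_pairPoints {l b : Ordinal.{u}} {c : Set Ordinal.{u}}
    {E : ℕ → Set Ordinal.{u}} (hb : ℵ₀ < b.cof) (hbl : b ≤ l) (hc : IsClubOf c b)
    (hE : ∀ n, IsClubOf (E n) l) (hanti : Antitone E)
    (hgap : IsStationaryOf (gapPoints c (⋂ n, E n)) b)
    (hglue : ∀ n, IsClubOf (glue (E n) c) b) :
    ∃ n, IsStationaryOf (pairPoints (glue (E n) c) (E (n + 1))) b := by
  have key : ∀ γ ∈ gapPoints c (⋂ n, E n), ∃ n,
      γ ∈ pairPoints (glue (E n) c) (E (n + 1)) := by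
    rintro γ ⟨hγc, hγE, x, hxE, hγx, hx⟩
    obtain ⟨η, hη⟩ : ∃ η, IsLeast {η | η ∈ c ∧ γ < η} η :=
      ⟨_, WellFounded.min_mem wellFounded_lt _ (hc.exists_gt hb (hc.1 hγc)),
        fun i hi ↦ WellFounded.min_le wellFounded_lt hi⟩
    have hxη : x ≤ η := hx η hη.1.1 hη.1.2
    choose i hi using fun n ↦
      (hE n).exists_isGreatest (mem_iInter.1 hxE n) hxη ((hc.1 hη.1.1).trans_le hbl)
    obtain ⟨n, hn⟩ := exists_nat_forall_ge_eq (i := i)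
      (antitone_nat_of_succ_le fun n ↦
        (hi n).2 ⟨hanti n.le_succ (hi (n + 1)).1.1, (hi (n + 1)).1.2⟩)
    -- Being in `E n`, `γ` is glued to itself; its successor `η` is glued to `i n = i (n + 1)`,
    -- which lies in `E (n + 1)`. The point `x` ensures `γ < i n`.
    refine ⟨n, ⟨γ, hγc, ⟨mem_iInter.1 hγE n, mem_Iic.2 le_rfl⟩, fun y hy ↦ hy.2⟩,
      mem_iInter.1 hγE _, i n, hn (n + 1) n.le_succ ▸ (hi (n + 1)).1.1,
      ⟨⟨η, hη.1.1, hi n⟩, hγx.trans_le ((hi n).2 ⟨mem_iInter.1 hxE n, hxη⟩)⟩, ?_⟩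
    rintro y ⟨⟨a, hac, hy⟩, hγy⟩
    have hηa : η ≤ a := hη.2 ⟨hac, hγy.trans_le hy.1.2⟩
    exact hy.2 ⟨(hi n).1.1, mem_Iic.2 (le_trans (hi n).1.2 hηa)⟩
  obtain ⟨n, hn⟩ := hgap.exists_nat hb
    (fun n γ ↦ γ ∈ pairPoints (glue (E n) c) (E (n + 1))) key
  exact ⟨n, hn.mono (fun γ hγ ↦ hγ.2) fun γ hγ ↦ (hglue n).1 hγ.1⟩

theorem exists_guesses_pairPoints {μ : Cardinal.{u}} {l : Ordinal.{u}} {S : Set Ordinal.{u}}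
    {C : Ordinal.{u} → Set Ordinal.{u}} (hμ : ℵ₀ < μ.ord.cof) (hl : ℵ₀ < l.cof)
    (hS : ∀ δ ∈ S, ℵ₀ < δ.cof ∧ δ ≤ l) (hC : IsClubSystem S C) (e : StrictSystem.{u})
    (he : Guesses μ l S C fun E β ↦ IsStationaryOf (gapPoints (e.1 β) E) β) :
    ∃ e' : StrictSystem.{u}, Guesses μ l S C
      fun E β ↦ IsStationaryOf (pairPoints (e'.1 β) E) β := by
  -- Each stage glues the original `e` afresh, so the gaps of one fixed club are compared with all
  -- the `E n`.
  refine exists_guesses hμ hl (fun δ hδ ↦ (hS δ hδ).1) e (fun _ E ↦ e.glue E) _ ?_ ?_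
  · intro e E F β hEF h
    refine h.mono ?_ fun x hx ↦ (e.2 β).1.1 hx.1
    rintro γ ⟨h1, h2, x, hx, h3⟩
    exact ⟨h1, hEF h2, x, hEF hx, h3⟩
  · intro e' E hE hanti he'
    obtain ⟨δ, hδS, hδ, hfreq⟩ := he _ (IsClubOf.iInter hl hE)
    refine ⟨δ, hδS, mem_iInter.1 hδ, ?_⟩
    intro α hα θ hθ
    obtain ⟨β, hβ, hαβ, hθβ, hgap⟩ := hfreq α hα (max θ ℵ₀)
      (max_lt hθ (hμ.trans_le (cof_ord_le μ)))
    have hβ0 : ℵ₀ < β.cof := (le_max_right _ _).trans_lt hθβ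
    have hβl : β ≤ l := (((hC δ hδS).1 hβ.1).trans_le (hS δ hδS).2).le
    have hunb : ∀ n, ∀ x < β, ∃ y ∈ E n, x ≤ y ∧ y < β := fun n ↦
      hgap.exists_between hβ0 fun γ hγ ↦ mem_iInter.1 hγ.2.1 n
    have hglue := fun n ↦ StrictSystem.glue_apply (e := e) (hE n) hβl (hunb n)
    obtain ⟨n, hn⟩ := exists_isStationaryOf_pairPoints hβ0 hβl (e.2 β).1 hE hanti hgap
      fun n ↦ hglue n ▸ ((e.glue (E n)).2 β).1
    refine ⟨β, hβ, hαβ, (le_max_left _ _).trans_lt hθβ, n + 1, ?_⟩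
    rwa [he', hglue]

theorem guesses_mem_of_notMem_idP {μ : Cardinal.{u}} {l : Ordinal.{u}} {S : Set Ordinal.{u}}
    {C : Ordinal.{u} → Set Ordinal.{u}} (h : Iio l ∉ idP l S C fun δ ↦ idealJb μ δ (C δ)) :
    Guesses μ l S C fun E β ↦ β ∈ E := by
  intro E hE
  by_contra! hcon
  refine h ⟨subset_rfl, E, hE, fun δ _ hδS hδE ↦ ⟨inter_subset_right, ?_⟩⟩
  have := hcon δ hδS hδE.1
  unfold FrequentlyNacc at this
  push Not at this
  obtain ⟨α, hα, θ, hθ, h⟩ := this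
  exact ⟨θ, hθ, α, hα, fun β hβ hβn hθβ ↦ not_lt.1 fun hαβ ↦ h β hβn hαβ hθβ hβ.1⟩

theorem claim3p3 (μ κ : Cardinal.{u}) (hμ : μ.IsSingular) (hκ : μ.ord.cof = κ) (hκ0 : ℵ₀ < κ)
    (S : Set Ordinal.{u}) (hS : ∀ δ ∈ S, δ < (succ μ).ord ∧ δ.cof = κ)
    (hSstat : IsStationaryOf S (succ μ).ord)
    (C : Ordinal.{u} → Set Ordinal.{u}) (hC : IsClubSystem S C)
    (hguess : Iio (succ μ).ord ∉ idP (succ μ).ord S C (fun δ => idealJb μ δ (C δ))) :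
    ∃ e : Ordinal.{u} → Set Ordinal.{u}, IsStrictClubSystem (Iio (succ μ).ord) e ∧
      ∀ E : Set Ordinal.{u}, IsClubOf E (succ μ).ord →
        IsStationaryOf
          {δ | δ ∈ S ∧ ∀ α < δ, ∀ θ < μ, ∃ β ∈ naccPoints (C δ), α < β ∧ θ < β.cof ∧
            IsStationaryOf
              {γ | γ ∈ e β ∧ γ ∈ E ∧ ∃ η ∈ E, IsLeast {x | x ∈ e β ∧ γ < x} η} β}
          (succ μ).ord := by
  subst hκ
  have hμ1 : ℵ₀ < μ := hκ0.trans_le (cof_ord_le μ)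
  have hl : ℵ₀ < (succ μ).ord.cof := by
    rw [(isRegular_succ hμ1.le).cof_ord]; exact hμ1.trans (lt_succ μ)
  have hS0 : ∀ δ ∈ S, ℵ₀ < δ.cof := fun δ hδ ↦ (hS δ hδ).2 ▸ hκ0
  obtain ⟨e₁, he₁⟩ := exists_guesses_gapPoints hμ hκ0 hS0 (guesses_mem_of_notMem_idP hguess)
  obtain ⟨e, he⟩ := exists_guesses_pairPoints hκ0 hl
    (fun δ hδ ↦ ⟨hS0 δ hδ, (hS δ hδ).1.le⟩) hC e₁ he₁
  refine ⟨e.1, ⟨fun δ _ ↦ (e.2 δ).1, fun δ _ ↦ (e.2 δ).type_eq⟩, fun E hE ↦ ?_⟩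
  refine isStationaryOf_of_forall (fun δ hδ ↦ (hS δ hδ.1).1) fun D hD ↦ ?_
  -- Guessing `E ∩ D` puts `δ` into the test club `D`, which turns one `δ` into stationarily many.
  obtain ⟨δ, hδS, hδ, hfreq⟩ := he _ (hE.inter hl hD)
  refine ⟨δ, ⟨hδS, fun α hα θ hθ ↦ ?_⟩, hδ.2⟩
  obtain ⟨β, h1, h2, h3, h4⟩ := hfreq α hα θ hθ
  refine ⟨β, h1, h2, h3, h4.mono ?_ fun x hx ↦ (e.2 β).1.1 hx.1⟩
  rintro γ ⟨hγ, hγE, η, hη, hleast⟩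
  exact ⟨hγ, hγE.1, η, hη.1, hleast⟩
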